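/- Let $k$ be an algebraically closed field (of any characteristic) and let $F_3$ be the free group on $A,B,C$. Let $R=\mathrm{Hom}(F_3,\mathrm{SL}_2(k))\cong \mathrm{SL}_2(k)^3$ be the affine algebraic set of representations, on which $\mathrm{SL}_2(k)$ acts by conjugation, with coordinate ring $\mathcal O(R)$. For $g\in F_3$ let $t_g:R\to k$, $t_g(\rho)=\operatorname{tr}\rho(g)$. The character variety $\mathfrak X_3=\mathfrak X(F_3,\mathrm{SL}_2)\subset k^{F_3}$ is the set of characters $\chi_\rho:g\mapsto \operatorname{tr}\rho(g)$, $\rho\in R$; its ring of functions is the $k$-algebra generated by all $t_g$, $g\in F_3$. Put $$(x,y,z,u,v,w,P)=(t_A,t_B,t_C,t_{BC},t_{AC},t_{AB},t_{ABC}).$$ Then these seven traces embed $\mathfrak X_3$ in $k^7$ as the hypersurface defined by the single equation $$P^2=(wz+vy+ux-xyz)P-x^2-y^2-z^2+uyz+vxz+wxy-uvw-u^2-v^2-w^2+4. \qquad (*)$$ That is: 1. the map $\mathfrak X_3\to k^7$ given by the seven traces is injective, its image is exactly the set of solutions of $(*)$, and the ideal of all polynomials vanishing on the image is the principal ideal $(f)$,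 where $f\in k[x,y,z,u,v,w,P]$ is the difference of the two sides of $(*)$; 2. the homomorphism from the polynomial ring $k[x,y,z,u,v,w,P]$ to functions on $R$ that sends the variables to the seven traces has kernel $(f)$, and its image is the whole ring of functions of $\mathfrak X_3$, which is also the ring of invariants $\mathcal O(R)^{\mathrm{SL}_2}$. In particular $k[x,y,z,u,v,w,P]/(f)$ is the coordinate ring of $\mathfrak X_3$ and of the GIT quotient $\mathrm{SL}_2(k)^3/\!/\mathrm{SL}_2$. -/

import Mathlib

open MvPolynomial

noncomputable section

namespace CharVar

/-- The representation space `R(Γ, SL_r) = Hom(Γ, SL_r(k))`. -/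
abbrev Rep (Γ : Type*) [Group Γ] (r : ℕ) (k : Type*) [Field k] : Type _ :=
  Γ →* Matrix.SpecialLinearGroup (Fin r) k

variable (Γ : Type*) [Group Γ] (r : ℕ) (k : Type*) [Field k]

/-- The coordinate ring of the affine algebraic set `R(Γ, SL_r)`: the algebra of functions on it
generated by the matrix entries of the `ρ g`. (Entries of inverses and products of matrices in
`SL_r` are polynomials in the entries of the factors, so letting `g` run over a generating set
of `Γ` gives the same algebra.) -/
def coordRing : Subalgebra k (Rep Γ r k → k) :=
  Algebra.adjoin k (Set.range fun (p : Γ × Fin r × Fin r) (ρ : Rep Γ r k) =>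
    (ρ p.1 : Matrix (Fin r) (Fin r) k) p.2.1 p.2.2)

variable {Γ r k} in
/-- The action of `SL_r(k)` on representations by conjugation, `g ↦ Q ρ(g) Q⁻¹`. -/
def conjRep (Q : Matrix.SpecialLinearGroup (Fin r) k) (ρ : Rep Γ r k) : Rep Γ r k :=
  (MulAut.conj Q).toMonoidHom.comp ρ

/-- The ring of invariants `𝒪^G` of the coordinate ring `𝒪` of `R(Γ, SL_r)` under conjugation by
`G = SL_r`, that is, the coordinate ring of the GIT quotient `R(Γ, SL_r) ⫽ SL_r`. -/
def invariantRing : Subalgebra k (Rep Γ r k → k) where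
  carrier := {f | f ∈ coordRing Γ r k ∧ ∀ Q ρ, f (conjRep Q ρ) = f ρ}
  mul_mem' := fun ha hb => ⟨mul_mem ha.1 hb.1, fun Q ρ => by
    simp only [Pi.mul_apply, ha.2 Q ρ, hb.2 Q ρ]⟩
  add_mem' := fun ha hb => ⟨add_mem ha.1 hb.1, fun Q ρ => by
    simp only [Pi.add_apply, ha.2 Q ρ, hb.2 Q ρ]⟩
  algebraMap_mem' := fun c => ⟨Subalgebra.algebraMap_mem _ c, fun _ _ => rfl⟩

variable {Γ r k} in
/-- The character `χ_ρ : Γ → k`, `χ_ρ(g) = tr ρ(g)`. -/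
def character (ρ : Rep Γ r k) : Γ → k :=
  fun g => (ρ g : Matrix (Fin r) (Fin r) k).trace

/-- The character variety `𝔛(Γ, SL_r)`: the image of the character map `R(Γ, SL_r) → k^Γ`. -/
def charVariety : Set (Γ → k) :=
  Set.range (character : Rep Γ r k → Γ → k)

/-- The ring of functions of `𝔛(Γ, SL_r)`, pulled back to `R(Γ, SL_r)`: the algebra
generated by the trace functions `ρ ↦ χ_ρ(g)`, for all `g` in `Γ`. -/
def traceRing : Subalgebra k (Rep Γ r k → k) :=
  Algebra.adjoin k (Set.range fun (g : Γ) (ρ : Rep Γ r k) => character ρ g)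

/-- The free group on three generators. -/
abbrev F₃ : Type := FreeGroup (Fin 3)

/-- The words `A, B, C, BC, AC, AB, ABC` in the free generators `A, B, C` of `F₃`. -/
def word : Fin 7 → F₃ :=
  let A : F₃ := FreeGroup.of 0
  let B : F₃ := FreeGroup.of 1
  let C : F₃ := FreeGroup.of 2
  ![A, B, C, B * C, A * C, A * B, A * B * C]

/-- The map `𝔛(F₃, SL₂) → k⁷`, `χ ↦ (t_A, t_B, t_C, t_BC, t_AC, t_AB, t_ABC)`. -/
def coords (χ : charVariety F₃ 2 k) : Fin 7 → k :=
  fun i => χ.1 (word i)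

/-- The map `k[x, y, z, u, v, w, P] → Fun(R(F₃, SL₂), k)` that sends the variables to the
functions `t_A, t_B, t_C, t_BC, t_AC, t_AB, t_ABC`. -/
def traceHom : MvPolynomial (Fin 7) k →ₐ[k] (Rep F₃ 2 k → k) :=
  aeval fun i ρ => character ρ (word i)

/-- The polynomial `P² - (right-hand side)` in the variables `(x, y, z, u, v, w, P)`. -/
def defPoly : MvPolynomial (Fin 7) k :=
  let x : MvPolynomial (Fin 7) k := X 0
  let y : MvPolynomial (Fin 7) k := X 1
  let z : MvPolynomial (Fin 7) k := X 2
  let u : MvPolynomial (Fin 7) k := X 3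
  let v : MvPolynomial (Fin 7) k := X 4
  let w : MvPolynomial (Fin 7) k := X 5
  let P : MvPolynomial (Fin 7) k := X 6
  P ^ 2 - ((w * z + v * y + u * x - x * y * z) * P - x ^ 2 - y ^ 2 - z ^ 2
    + u * y * z + v * x * z + w * x * y - u * v * w - u ^ 2 - v ^ 2 - w ^ 2 + 4)

end CharVar

end

open MvPolynomial

noncomputable section

namespace CharVar

open Matrix

/-! The traces of `ABC` and `ACB` have sum and product polynomial in the other six traces; this is
the equation `f`. Let `κ = kappa x y w`. If `κ ≠ 0`, then `A` and `B` share no eigenvector, and the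
pair is conjugate to a normal form given by `x, y, w` and an eigenvalue `s` of `AB`. The other
traces then impose a linear system on `C` with solution in denominators `κ`. This realizes the
points with `κ ≠ 0`. At the remaining points the first six traces are realized by exchanging `B` and
`C` or by triangular matrices, and transposing all matrices exchanges the two roots `P`
(`exists_rep`).

Modulo `f`, a polynomial is linear in `P`. If it vanishes at both roots, it is zero, because the
discriminant is a nonzero polynomial in every characteristic (`defPoly_dvd_of_vanish`).

An invariant function can be evaluated on the normal form, so a power of `κ` times it is a
polynomial in the traces and `s`. Independence of the choice of `s` removes `s`. Exchanging `B` and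
`C` gives a second denominator `κ' = kappa x z v`, coprime to `κ`, so no denominator is needed
(`invariantRing_le_range_traceHom`). Hence polynomials in the seven traces, the trace ring and the
invariants coincide, and each `t_g` is a function of the seven traces, which gives injectivity. -/

/-- The trace of the commutator of two elements of `SL₂` with traces `x`, `y` and trace of the
product `w`, minus `2`. It vanishes exactly on reducible pairs. -/
def kappa {R : Type*} [CommRing R] (x y w : R) : R :=
  x ^ 2 + y ^ 2 + w ^ 2 - x * y * w - 4

/-- The equation of the character variety. -/
def IsFricke {R : Type*} [CommRing R] (q : Fin 7 → R) : Prop :=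
  q 6 ^ 2 = (q 5 * q 2 + q 4 * q 1 + q 3 * q 0 - q 0 * q 1 * q 2) * q 6
    - q 0 ^ 2 - q 1 ^ 2 - q 2 ^ 2 + q 3 * q 1 * q 2 + q 4 * q 0 * q 2 + q 5 * q 0 * q 1
    - q 3 * q 4 * q 5 - q 3 ^ 2 - q 4 ^ 2 - q 5 ^ 2 + 4

/-- The Fricke relation for three arbitrary `2 × 2` matrices. -/
theorem fricke_identity {R : Type*} [CommRing R] (A B C : Matrix (Fin 2) (Fin 2) R) :
    (A * B * C).trace ^ 2 - ((A * B).trace * C.trace + (A * C).trace * B.trace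
      + (B * C).trace * A.trace - A.trace * B.trace * C.trace) * (A * B * C).trace
      + A.trace ^ 2 * B.det * C.det + B.trace ^ 2 * A.det * C.det + C.trace ^ 2 * A.det * B.det
      + (B * C).trace ^ 2 * A.det + (A * C).trace ^ 2 * B.det + (A * B).trace ^ 2 * C.det
      - (B * C).trace * B.trace * C.trace * A.det - (A * C).trace * A.trace * C.trace * B.det
      - (A * B).trace * A.trace * B.trace * C.det
      + (B * C).trace * (A * C).trace * (A * B).trace - 4 * A.det * B.det * C.det = 0 := by
  simp only [Matrix.trace_fin_two, Matrix.det_fin_two, Matrix.mul_apply, Fin.sum_univ_two]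
  ring

/-! ### Traces of representations of the free group -/

variable {k : Type*} [Field k]

/-- The seven traces of a representation of `F₃`. -/
def tvec (ρ : Rep F₃ 2 k) : Fin 7 → k := fun i => character ρ (word i)

theorem traceHom_apply (p : MvPolynomial (Fin 7) k) (ρ : Rep F₃ 2 k) :
    traceHom k p ρ = eval (tvec ρ) p := by
  induction p using MvPolynomial.induction_on with
  | C a => simp [traceHom]
  | add p q hp hq => simp [hp, hq]
  | mul_X p i hp => simp [hp]; simp [traceHom, tvec]

/-- The matrix of the `i`-th generator. -/
abbrev gen (ρ : Rep F₃ 2 k) (i : Fin 3) : Matrix (Fin 2) (Fin 2) k :=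
  (ρ (FreeGroup.of i)).1

theorem tvec_eq (ρ : Rep F₃ 2 k) : tvec ρ = ![(gen ρ 0).trace, (gen ρ 1).trace, (gen ρ 2).trace,
    (gen ρ 1 * gen ρ 2).trace, (gen ρ 0 * gen ρ 2).trace, (gen ρ 0 * gen ρ 1).trace,
    (gen ρ 0 * gen ρ 1 * gen ρ 2).trace] := by
  funext i
  fin_cases i <;> simp [tvec, word, character, gen]

theorem isFricke_tvec (ρ : Rep F₃ 2 k) : IsFricke (tvec ρ) := by
  have h := fricke_identity (gen ρ 0) (gen ρ 1) (gen ρ 2)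
  have h0 : (gen ρ 0).det = 1 := (ρ (FreeGroup.of 0)).2
  have h1 : (gen ρ 1).det = 1 := (ρ (FreeGroup.of 1)).2
  have h2 : (gen ρ 2).det = 1 := (ρ (FreeGroup.of 2)).2
  rw [h0, h1, h2] at h
  rw [tvec_eq]
  simp only [IsFricke, cons_val]
  linear_combination h

theorem eval_defPoly (q : Fin 7 → k) : eval q (defPoly k) = 0 ↔ IsFricke q := by
  rw [IsFricke, ← sub_eq_zero (a := q 6 ^ 2)]
  simp [defPoly]

theorem character_conjRep {Γ : Type*} [Group Γ] {r : ℕ} (Q : SpecialLinearGroup (Fin r) k)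
    (ρ : Rep Γ r k) : character (conjRep Q ρ) = character ρ := by
  funext g
  change (Q.1 * (ρ g).1 * (Q⁻¹).1).trace = (ρ g).1.trace
  have h : (Q⁻¹).1 * Q.1 = 1 := congrArg Subtype.val (inv_mul_cancel Q)
  rw [Matrix.trace_mul_comm, ← Matrix.mul_assoc, h, Matrix.one_mul]

theorem tvec_conjRep (Q : SpecialLinearGroup (Fin 2) k) (ρ : Rep F₃ 2 k) :
    tvec (conjRep Q ρ) = tvec ρ := by
  funext i
  simp [tvec, character_conjRep]

/-- The representation of `F₃` with given images of the generators. -/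
def mkRep (A B C : Matrix (Fin 2) (Fin 2) k) (hA : A.det = 1) (hB : B.det = 1) (hC : C.det = 1) :
    Rep F₃ 2 k := FreeGroup.lift ![⟨A, hA⟩, ⟨B, hB⟩, ⟨C, hC⟩]

theorem tvec_mkRep (A B C : Matrix (Fin 2) (Fin 2) k) (hA : A.det = 1) (hB : B.det = 1)
    (hC : C.det = 1) : tvec (mkRep A B C hA hB hC) = ![A.trace, B.trace, C.trace,
      (B * C).trace, (A * C).trace, (A * B).trace, (A * B * C).trace] := by
  rw [tvec_eq]
  simp [gen, mkRep]

/-! ### Surjectivity onto the hypersurface -/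

/-- The monic quadratic equation `s² - b s + c = 0` has a root. -/
theorem exists_quadratic_root [IsAlgClosed k] (b c : k) : ∃ s : k, s ^ 2 - b * s + c = 0 := by
  obtain ⟨s, hs⟩ := IsAlgClosed.exists_root
    (Polynomial.X ^ 2 - Polynomial.C b * Polynomial.X + Polynomial.C c : Polynomial k) (by
      have : (Polynomial.X ^ 2 - Polynomial.C b * Polynomial.X + Polynomial.C c :
        Polynomial k).degree = 2 := by compute_degree!
      rw [this]; decide)
  exact ⟨s, by simpa using hs⟩

/-- Upper left entry of `kappa • C`, for `C` with given traces against a normalized pair. -/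
def sliceEntry₁ {R : Type*} [CommRing R] (q : Fin 7 → R) (s : R) : R :=
  (q 0 * (q 5 - s) - q 1) * (q 3 + s * q 4 - q 1 * q 2)
    - (q 5 - 2 * s) * (q 6 - (q 5 - s) * q 2)

/-- Lower left entry of `kappa • C`, for `C` with given traces against a normalized pair. -/
def sliceEntry₃ {R : Type*} [CommRing R] (q : Fin 7 → R) (s : R) : R :=
  (s * q 0 - q 1) * (q 6 - (q 5 - s) * q 2)
    + (q 5 - 2 * s) * (q 3 + s * q 4 - q 1 * q 2)

/-- The normalized pair `(A, B)` and the matrix `kappa • C`, as the entries of three matrices. -/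
def slice {R : Type*} [CommRing R] (q : Fin 7 → R) (s : R) : Fin 3 → Matrix (Fin 2) (Fin 2) R :=
  ![kappa (q 0) (q 1) (q 5) • !![q 0, -1; 1, 0],
    kappa (q 0) (q 1) (q 5) • !![0, q 5 - s; -s, q 1],
    !![sliceEntry₁ q s,
       kappa (q 0) (q 1) (q 5) * q 4 - q 0 * sliceEntry₁ q s + sliceEntry₃ q s;
       sliceEntry₃ q s, kappa (q 0) (q 1) (q 5) * q 2 - sliceEntry₁ q s]]

/-- A triple whose first two members are normalized is determined by its traces. -/
theorem kappa_smul_gen_of_normalized {ρ : Rep F₃ 2 k} {s : k}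
    (hs : s ^ 2 - tvec ρ 5 * s + 1 = 0)
    (h0 : gen ρ 0 = !![tvec ρ 0, -1; 1, 0])
    (h1 : gen ρ 1 = !![0, tvec ρ 5 - s; -s, tvec ρ 1]) (i : Fin 3) :
    kappa (tvec ρ 0) (tvec ρ 1) (tvec ρ 5) • gen ρ i = slice (tvec ρ) s i := by
  have h := tvec_eq ρ
  have e2 := congrFun h 2
  have e3 := congrFun h 3
  have e4 := congrFun h 4
  have e6 := congrFun h 6
  clear h
  set q := tvec ρ
  fin_cases i
  · simp [slice, h0]
  · simp [slice, h1]
  · rw [h0, h1] at e3 e6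
    rw [h0] at e4
    simp [Matrix.trace_fin_two, Matrix.vecMul, dotProduct] at e2 e3 e4 e6
    -- The traces of `C` and `AC` eliminate the right column of `C`. Those of `BC` and `ABC` leave a
    -- 2 × 2 system in the left column with determinant `kappa`, by `s * (w - s) = 1`; this is
    -- Cramer's rule.
    have k1 : kappa (q 0) (q 1) (q 5) * gen ρ 2 0 0 = sliceEntry₁ q s := by
      simp only [kappa, sliceEntry₁]
      rw [e2, e3, e4, e6]
      linear_combination gen ρ 2 0 0 * (q 0 ^ 2 - 4) * hs
    have k3 : kappa (q 0) (q 1) (q 5) * gen ρ 2 1 0 = sliceEntry₃ q s := by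
      simp only [kappa, sliceEntry₃]
      rw [e2, e3, e4, e6]
      linear_combination gen ρ 2 1 0 * (q 0 ^ 2 - 4) * hs
    ext i j
    fin_cases i <;> fin_cases j <;> simp [slice]
    · exact k1
    · rw [← k1, ← k3, e4]; ring
    · exact k3
    · rw [← k1, e2]; ring

/-- A point of the hypersurface with `kappa ≠ 0` is realized by a normalized triple. -/
theorem exists_rep_of_kappa_ne_zero [IsAlgClosed k] (q : Fin 7 → k) (hq : IsFricke q)
    (hκ : kappa (q 0) (q 1) (q 5) ≠ 0) : ∃ ρ : Rep F₃ 2 k, tvec ρ = q := by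
  obtain ⟨s, hs⟩ := exists_quadratic_root (q 5) 1
  set κ := kappa (q 0) (q 1) (q 5) with hκd
  obtain ⟨c1, h1⟩ : ∃ c, κ * c = sliceEntry₁ q s := ⟨_, mul_div_cancel₀ _ hκ⟩
  obtain ⟨c3, h3⟩ : ∃ c, κ * c = sliceEntry₃ q s := ⟨_, mul_div_cancel₀ _ hκ⟩
  set A : Matrix (Fin 2) (Fin 2) k := !![q 0, -1; 1, 0]
  set B : Matrix (Fin 2) (Fin 2) k := !![0, q 5 - s; -s, q 1]
  set C : Matrix (Fin 2) (Fin 2) k := !![c1, q 4 - q 0 * c1 + c3; c3, q 2 - c1]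
  have hA : A.det = 1 := by simp [A]
  have hB : B.det = 1 := by simp [B]; linear_combination -hs
  have tA : A.trace = q 0 := by simp [A, Matrix.trace_fin_two]
  have tB : B.trace = q 1 := by simp [B, Matrix.trace_fin_two]
  have tC : C.trace = q 2 := by simp [C, Matrix.trace_fin_two]
  have tAB : (A * B).trace = q 5 := by simp [A, B, Matrix.trace_fin_two]
  have tAC : (A * C).trace = q 4 := by simp [A, C, Matrix.trace_fin_two]; ring
  have tBC : (B * C).trace = q 3 := by
    apply mul_left_cancel₀ hκ
    simp only [B, C, Matrix.trace_fin_two, Matrix.mul_apply, Fin.sum_univ_two]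
    simp only [of_apply, cons_val', cons_val_zero, cons_val_one, cons_val_fin_one]
    simp only [sliceEntry₁, sliceEntry₃] at h1 h3
    simp only [hκd, kappa] at *
    linear_combination (s * q 0 - q 1) * h1 + (q 5 - 2 * s) * h3
      - (q 0 ^ 2 - 4) * (q 3 + s * q 4 - q 1 * q 2) * hs
  have tABC : (A * B * C).trace = q 6 := by
    apply mul_left_cancel₀ hκ
    simp only [A, B, C, Matrix.trace_fin_two, Matrix.mul_apply, Fin.sum_univ_two]
    simp only [of_apply, cons_val', cons_val_zero, cons_val_one, cons_val_fin_one]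
    simp only [sliceEntry₁, sliceEntry₃] at h1 h3
    simp only [hκd, kappa] at *
    linear_combination (2 * s - q 5) * h1 + (q 0 * (q 5 - s) - q 1) * h3
      - (q 0 ^ 2 - 4) * (q 6 - (q 5 - s) * q 2) * hs
  -- The Fricke relation with `C.det` unknown is affine in it with leading coefficient `kappa`, and
  -- the equation of the hypersurface says that `1` solves it.
  have hC : C.det = 1 := by
    have h := fricke_identity A B C
    rw [hA, hB, tA, tB, tC, tAB, tAC, tBC, tABC] at h
    apply mul_left_cancel₀ hκ
    simp only [hκd, kappa]
    simp only [IsFricke] at hq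
    linear_combination h - hq
  refine ⟨mkRep A B C hA hB hC, ?_⟩
  rw [tvec_mkRep, tA, tB, tC, tAB, tAC, tBC, tABC]
  funext i
  fin_cases i <;> rfl

/-! ### Symmetries: exchange of two generators and transposition -/

/-- The action on representations of the automorphism of `F₃` that exchanges `B` and `C`. -/
def swapRep (ρ : Rep F₃ 2 k) : Rep F₃ 2 k :=
  ρ.comp (FreeGroup.map (Equiv.swap (1 : Fin 3) 2))

theorem swapRep_swapRep (ρ : Rep F₃ 2 k) : swapRep (swapRep ρ) = ρ := by
  apply FreeGroup.ext_hom
  intro i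
  simp [swapRep]

theorem gen_swapRep (ρ : Rep F₃ 2 k) (i : Fin 3) :
    gen (swapRep ρ) i = gen ρ (Equiv.swap (1 : Fin 3) 2 i) := by
  simp [swapRep, gen]

/-- The sum of the traces of `ABC` and `ACB`. -/
def traceSum {R : Type*} [CommRing R] (q : Fin 7 → R) : R :=
  q 5 * q 2 + q 4 * q 1 + q 3 * q 0 - q 0 * q 1 * q 2

/-- The effect of exchanging `B` and `C` on the seven traces. -/
def swapVec {R : Type*} [CommRing R] (q : Fin 7 → R) : Fin 7 → R :=
  ![q 0, q 2, q 1, q 3, q 5, q 4, traceSum q - q 6]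

theorem trace_mul_swap {R : Type*} [CommRing R] (A B C : Matrix (Fin 2) (Fin 2) R) :
    (A * C * B).trace = (A * B).trace * C.trace + (A * C).trace * B.trace
      + (B * C).trace * A.trace - A.trace * B.trace * C.trace - (A * B * C).trace := by
  simp only [Matrix.trace_fin_two, Matrix.mul_apply, Fin.sum_univ_two]
  ring

theorem tvec_swapRep (ρ : Rep F₃ 2 k) : tvec (swapRep ρ) = swapVec (tvec ρ) := by
  rw [tvec_eq, tvec_eq]
  have e1 : Equiv.swap (1 : Fin 3) 2 0 = 0 := by decide
  simp only [gen_swapRep, swapVec, traceSum, e1, Equiv.swap_apply_left, Equiv.swap_apply_right,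
    cons_val, trace_mul_swap (gen ρ 0) (gen ρ 1), Matrix.trace_mul_comm (gen ρ 2) (gen ρ 1)]

/-- The representation given by transposed generators. -/
def transposeRep (ρ : Rep F₃ 2 k) : Rep F₃ 2 k :=
  mkRep (gen ρ 0)ᵀ (gen ρ 1)ᵀ (gen ρ 2)ᵀ
    (by rw [det_transpose]; exact (ρ (FreeGroup.of 0)).2)
    (by rw [det_transpose]; exact (ρ (FreeGroup.of 1)).2)
    (by rw [det_transpose]; exact (ρ (FreeGroup.of 2)).2)

/-- `AᵀBᵀCᵀ` is the transpose of `CBA`, which has the trace of `ACB`; words of length at most two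
keep their traces. -/
theorem tvec_transposeRep (ρ : Rep F₃ 2 k) :
    tvec (transposeRep ρ) = Function.update (tvec ρ) 6 (traceSum (tvec ρ) - tvec ρ 6) := by
  rw [transposeRep, tvec_mkRep, tvec_eq]
  funext i
  fin_cases i <;>
    simp [Function.update, traceSum, Matrix.trace_fin_two, Matrix.mul_apply, Fin.sum_univ_two]
  all_goals ring

theorem exists_eq_add_inv [IsAlgClosed k] (x : k) : ∃ a : k, a ≠ 0 ∧ x = a + a⁻¹ := by
  obtain ⟨a, ha⟩ := exists_quadratic_root x 1
  have h0 : a ≠ 0 := by rintro rfl; simp at ha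
  exact ⟨a, h0, by field_simp; linear_combination -ha⟩

/-- For `y = b + b⁻¹`, `kappa` factors as a quadratic in `w`, and `b ↦ b⁻¹` exchanges its two roots.
-/
theorem exists_of_kappa_eq_zero [IsAlgClosed k] {a y w : k} (ha : a ≠ 0)
    (h : kappa (a + a⁻¹) y w = 0) :
    ∃ b : k, b ≠ 0 ∧ y = b + b⁻¹ ∧ w = a * b + a⁻¹ * b⁻¹ := by
  obtain ⟨b, hb, rfl⟩ := exists_eq_add_inv y
  have : (w - (a * b + a⁻¹ * b⁻¹)) * (w - (a * b⁻¹ + a⁻¹ * b)) = 0 := by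
    rw [← h, kappa]; field_simp; ring
  rcases mul_eq_zero.1 this with h | h
  · exact ⟨b, hb, rfl, sub_eq_zero.1 h⟩
  · exact ⟨b⁻¹, inv_ne_zero hb, by rw [inv_inv, add_comm], by rw [inv_inv]; exact sub_eq_zero.1 h⟩

/-- All values of the first six traces occur. -/
theorem exists_rep_six [IsAlgClosed k] (q : Fin 7 → k) :
    ∃ (ρ : Rep F₃ 2 k) (P : k), tvec ρ = Function.update q 6 P := by
  by_cases h1 : kappa (q 0) (q 1) (q 5) = 0
  · by_cases h2 : kappa (q 0) (q 2) (q 4) = 0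
    · obtain ⟨a, ha, hx⟩ := exists_eq_add_inv (q 0)
      rw [hx] at h1 h2
      obtain ⟨b, hb, hy, hw⟩ := exists_of_kappa_eq_zero ha h1
      obtain ⟨c, hc, hz, hv⟩ := exists_of_kappa_eq_zero ha h2
      -- As `A` is diagonal, the off-diagonal entries of `B` and `C` affect only the trace of `BC`
      -- among the six, so the lower left entry of `C` can be chosen to make it `q 3`.
      refine ⟨mkRep !![a, 0; 0, a⁻¹] !![b, 1; 0, b⁻¹] !![c, 0; q 3 - b * c - b⁻¹ * c⁻¹, c⁻¹]
        (by simp [ha]) (by simp [hb]) (by simp [hc]), (!![a, 0; 0, a⁻¹] * !![b, 1; 0, b⁻¹]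
          * !![c, 0; q 3 - b * c - b⁻¹ * c⁻¹, c⁻¹]).trace, ?_⟩
      rw [tvec_mkRep]
      funext i
      fin_cases i
      · simp [Matrix.trace_fin_two, hx]
      · simp [Matrix.trace_fin_two, hy]
      · simp [Matrix.trace_fin_two, hz]
      · simp [Matrix.trace_fin_two, Function.update]; ring
      · simp [Matrix.trace_fin_two, Function.update, hv]
      · simp [Matrix.trace_fin_two, Function.update, hw]
      · rfl
    · set q' := swapVec q
      obtain ⟨P, hP⟩ := exists_quadratic_root (traceSum q') (-(
        - q' 0 ^ 2 - q' 1 ^ 2 - q' 2 ^ 2 + q' 3 * q' 1 * q' 2 + q' 4 * q' 0 * q' 2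
        + q' 5 * q' 0 * q' 1 - q' 3 * q' 4 * q' 5 - q' 3 ^ 2 - q' 4 ^ 2 - q' 5 ^ 2 + 4))
      obtain ⟨ρ, hρ⟩ := exists_rep_of_kappa_ne_zero (Function.update q' 6 P)
        (by simp [IsFricke, Function.update]; simp [traceSum] at hP; linear_combination hP)
        (by simpa [Function.update, q', swapVec] using h2)
      refine ⟨swapRep ρ, traceSum q' - P, ?_⟩
      rw [tvec_swapRep, hρ]
      funext i
      fin_cases i <;> simp [swapVec, Function.update, q', traceSum]
  · obtain ⟨P, hP⟩ := exists_quadratic_root (traceSum q) (-(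
      - q 0 ^ 2 - q 1 ^ 2 - q 2 ^ 2 + q 3 * q 1 * q 2 + q 4 * q 0 * q 2
      + q 5 * q 0 * q 1 - q 3 * q 4 * q 5 - q 3 ^ 2 - q 4 ^ 2 - q 5 ^ 2 + 4))
    obtain ⟨ρ, hρ⟩ := exists_rep_of_kappa_ne_zero (Function.update q 6 P)
      (by simp [IsFricke, Function.update]; simp [traceSum] at hP; linear_combination hP)
      (by simpa [Function.update] using h1)
    exact ⟨ρ, P, hρ⟩

/-- Every point of the hypersurface is the point of a representation. -/
theorem exists_rep [IsAlgClosed k] (q : Fin 7 → k) (hq : IsFricke q) :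
    ∃ ρ : Rep F₃ 2 k, tvec ρ = q := by
  obtain ⟨ρ, P, hρ⟩ := exists_rep_six q
  have h := isFricke_tvec ρ
  rw [hρ] at h
  -- `P` and `q 6` are roots of the same monic quadratic, whose roots sum to `traceSum q`.
  have hz : (q 6 - P) * (q 6 - (traceSum q - P)) = 0 := by
    simp [IsFricke, Function.update] at h hq
    simp only [traceSum]
    linear_combination hq - h
  rcases mul_eq_zero.1 hz with h' | h'
  · refine ⟨ρ, ?_⟩
    rw [hρ, ← sub_eq_zero.1 h', Function.update_eq_self]
  · refine ⟨transposeRep ρ, ?_⟩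
    have e : traceSum (Function.update q 6 P) = traceSum q := by simp [traceSum, Function.update]
    rw [tvec_transposeRep, hρ, e, Function.update_idem, Function.update_self, ← sub_eq_zero.1 h',
      Function.update_eq_self]

/-! ### Normalizing an irreducible pair -/

theorem kappa_eq_neg_det {R : Type*} [CommRing R] (A B : Matrix (Fin 2) (Fin 2) R)
    (hA : A.det = 1) (hB : B.det = 1) :
    kappa A.trace B.trace (A * B).trace = -(A * B - B * A).det := by
  have : A.trace ^ 2 * B.det + B.trace ^ 2 * A.det + (A * B).trace ^ 2
    - A.trace * B.trace * (A * B).trace - 4 * A.det * B.det = -(A * B - B * A).det := by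
    simp only [Matrix.trace_fin_two, Matrix.mul_apply, Fin.sum_univ_two, Matrix.det_fin_two,
      Matrix.sub_apply]
    ring
  rw [hA, hB] at this
  rw [← this, kappa]; ring

/-- A pair with `kappa ≠ 0` can be conjugated to the normal form attached to an eigenvalue of
the product. -/
theorem exists_conj_normalized [IsAlgClosed k] (A B : Matrix (Fin 2) (Fin 2) k)
    (hA : A.det = 1) (hB : B.det = 1) {s : k} (hs : s ^ 2 - (A * B).trace * s + 1 = 0)
    (hκ : kappa A.trace B.trace (A * B).trace ≠ 0) :
    ∃ M : SpecialLinearGroup (Fin 2) k, A * M.1 = M.1 * !![A.trace, -1; 1, 0] ∧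
      B * M.1 = M.1 * !![0, (A * B).trace - s; -s, B.trace] := by
  obtain ⟨e, he, hes⟩ : ∃ e : Fin 2 → k, e ≠ 0 ∧ (A * B - s • 1) *ᵥ e = 0 := by
    apply Matrix.exists_mulVec_eq_zero_iff.2
    have hd : (A * B).det = 1 := by rw [det_mul, hA, hB, one_mul]
    rw [Matrix.det_fin_two, Matrix.trace_fin_two] at *
    simp only [Matrix.sub_apply, Matrix.smul_apply, Matrix.one_apply, smul_eq_mul]
    simp
    linear_combination hs + hd
  have h0 : (A 0 0 * B 0 0 + A 0 1 * B 1 0) * e 0 + (A 0 0 * B 0 1 + A 0 1 * B 1 1) * e 1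
      = s * e 0 := by
    have := congrFun hes 0
    simp [Matrix.mulVec, dotProduct, Matrix.mul_apply, Fin.sum_univ_two] at this
    linear_combination this
  have h1 : (A 1 0 * B 0 0 + A 1 1 * B 1 0) * e 0 + (A 1 0 * B 0 1 + A 1 1 * B 1 1) * e 1
      = s * e 1 := by
    have := congrFun hes 1
    simp [Matrix.mulVec, dotProduct, Matrix.mul_apply, Fin.sum_univ_two] at this
    linear_combination this
  rw [Matrix.det_fin_two] at hA
  -- `b0` and `b1` say that `B e = s A⁻¹ e`, with `A⁻¹` the adjugate.
  have b0 : B 0 0 * e 0 + B 0 1 * e 1 = s * (A 1 1 * e 0 - A 0 1 * e 1) := by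
    linear_combination A 1 1 * h0 - A 0 1 * h1 - (B 0 0 * e 0 + B 0 1 * e 1) * hA
  have b1 : B 1 0 * e 0 + B 1 1 * e 1 = -s * (A 1 0 * e 0 - A 0 0 * e 1) := by
    linear_combination -A 1 0 * h0 + A 0 0 * h1 - (B 1 0 * e 0 + B 1 1 * e 1) * hA
  -- This is the determinant of `(e, A e)`. If it vanished, `e` would be an eigenvector of `A`,
  -- hence of `B`, and `AB - BA` would kill it.
  have hd : A 1 0 * e 0 ^ 2 + (A 1 1 - A 0 0) * e 0 * e 1 - A 0 1 * e 1 ^ 2 ≠ 0 := by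
    intro hd
    apply hκ
    rw [kappa_eq_neg_det A B (by rw [Matrix.det_fin_two, hA]) hB, neg_eq_zero,
      ← Matrix.exists_mulVec_eq_zero_iff]
    refine ⟨e, he, ?_⟩
    obtain ⟨l, E0, E1⟩ : ∃ l, A 0 0 * e 0 + A 0 1 * e 1 = l * e 0 ∧
        A 1 0 * e 0 + A 1 1 * e 1 = l * e 1 := by
      by_cases h : e 0 = 0
      · have h' : e 1 ≠ 0 := fun h' => he (by funext i; fin_cases i <;> simp [h, h'])
        refine ⟨(A 1 0 * e 0 + A 1 1 * e 1) / e 1, ?_, ?_⟩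
        · field_simp; linear_combination -hd
        · field_simp
      · refine ⟨(A 0 0 * e 0 + A 0 1 * e 1) / e 0, ?_, ?_⟩
        · field_simp
        · field_simp; linear_combination hd
    funext i
    fin_cases i
    · simp [Matrix.mulVec, dotProduct, Matrix.mul_apply, Fin.sum_univ_two]
      linear_combination h0 - B 0 0 * E0 - B 0 1 * E1 - l * b0 + s * (A 1 1 * E0 - A 0 1 * E1)
        - s * e 0 * hA
    · simp [Matrix.mulVec, dotProduct, Matrix.mul_apply, Fin.sum_univ_two]
      linear_combination h1 - B 1 0 * E0 - B 1 1 * E1 - l * b1 + s * (A 0 0 * E1 - A 1 0 * E0)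
        - s * e 1 * hA
  obtain ⟨t, ht⟩ := IsAlgClosed.exists_pow_nat_eq
    (A 1 0 * e 0 ^ 2 + (A 1 1 - A 0 0) * e 0 * e 1 - A 0 1 * e 1 ^ 2) (n := 2) (by norm_num)
  have ht0 : t ≠ 0 := by rintro rfl; exact hd (by rw [← ht]; ring)
  -- The new basis is `e`, `-A⁻¹ e`, scaled by a square root of its determinant to land in `SL₂`.
  refine ⟨⟨!![e 0 / t, -(A 1 1 * e 0 - A 0 1 * e 1) / t; e 1 / t, (A 1 0 * e 0 - A 0 0 * e 1) / t],
    ?_⟩, ?_, ?_⟩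
  · rw [Matrix.det_fin_two_of]
    field_simp
    linear_combination -ht
  · ext i j
    fin_cases i <;> fin_cases j <;>
      simp [Matrix.mul_apply, Fin.sum_univ_two, Matrix.trace_fin_two] <;> field_simp
    · ring
    · linear_combination -e 0 * hA
    · ring
    · linear_combination -e 1 * hA
  · ext i j
    fin_cases i <;> fin_cases j <;>
      simp [Matrix.mul_apply, Fin.sum_univ_two, Matrix.trace_fin_two] <;> field_simp
    · linear_combination b0
    · linear_combination -h0
    · linear_combination b1
    · linear_combination -h1

/-- A representation with `kappa ≠ 0` on the first two generators can be normalized. -/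
theorem exists_conjRep_normalized [IsAlgClosed k] (ρ : Rep F₃ 2 k) {s : k}
    (hs : s ^ 2 - tvec ρ 5 * s + 1 = 0) (hκ : kappa (tvec ρ 0) (tvec ρ 1) (tvec ρ 5) ≠ 0) :
    ∃ Q, ∀ i, kappa (tvec ρ 0) (tvec ρ 1) (tvec ρ 5) • gen (conjRep Q ρ) i
      = slice (tvec ρ) s i := by
  have t0 : tvec ρ 0 = (gen ρ 0).trace := by rw [tvec_eq]; rfl
  have t1 : tvec ρ 1 = (gen ρ 1).trace := by rw [tvec_eq]; rfl
  have t5 : tvec ρ 5 = (gen ρ 0 * gen ρ 1).trace := by rw [tvec_eq]; rfl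
  obtain ⟨M, hMA, hMB⟩ := exists_conj_normalized (gen ρ 0) (gen ρ 1) (ρ (FreeGroup.of 0)).2
    (ρ (FreeGroup.of 1)).2 (s := s) (by rwa [← t5]) (by rwa [← t0, ← t1, ← t5])
  rw [← t0] at hMA
  rw [← t1, ← t5] at hMB
  have hM : (M⁻¹).1 * M.1 = 1 := congrArg Subtype.val (inv_mul_cancel M)
  have hg (i) (N : Matrix (Fin 2) (Fin 2) k) (h : gen ρ i * M.1 = M.1 * N) :
      gen (conjRep M⁻¹ ρ) i = N := by
    have : gen (conjRep M⁻¹ ρ) i = (M⁻¹).1 * gen ρ i * (M⁻¹⁻¹).1 := rfl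
    rw [this, inv_inv, Matrix.mul_assoc, h, ← Matrix.mul_assoc, hM, Matrix.one_mul]
  refine ⟨M⁻¹, fun i => ?_⟩
  have ht := tvec_conjRep M⁻¹ ρ
  have := kappa_smul_gen_of_normalized (ρ := conjRep M⁻¹ ρ) (s := s) (by rw [ht, hs])
    (by rw [ht, hg 0 _ hMA]) (by rw [ht, hg 1 _ hMB]) i
  rwa [ht] at this

/-! ### The coordinate ring is a domain -/

/-- The entries of the images of the generators. -/
def ents (ρ : Rep F₃ 2 k) (m : Fin 3 × Fin 2 × Fin 2) : k := gen ρ m.1 m.2.1 m.2.2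

variable (k) in
/-- Polynomials in the entries of the generators, as functions on the representation space. -/
def entHom : MvPolynomial (Fin 3 × Fin 2 × Fin 2) k →ₐ[k] (Rep F₃ 2 k → k) :=
  aeval fun m ρ => ents ρ m

theorem entHom_apply (p : MvPolynomial (Fin 3 × Fin 2 × Fin 2) k) (ρ : Rep F₃ 2 k) :
    entHom k p ρ = eval (ents ρ) p := by
  induction p using MvPolynomial.induction_on with
  | C a => simp [entHom]
  | add p q hp hq => simp [hp, hq]
  | mul_X p i hp => simp [hp]; simp [entHom]

/-- The inverse of a matrix in `SL₂` is its adjugate, so entries at any word are polynomials in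
those at the generators. -/
theorem coordRing_le_range_entHom : coordRing F₃ 2 k ≤ (entHom k).range := by
  refine Algebra.adjoin_le ?_
  rintro _ ⟨⟨g, i, j⟩, rfl⟩
  suffices H : ∀ i j, (fun ρ : Rep F₃ 2 k => (ρ g).1 i j) ∈ (entHom k).range from H i j
  have hof (m : Fin 3) (i j : Fin 2) :
      (fun ρ : Rep F₃ 2 k => (ρ (FreeGroup.of m)).1 i j) ∈ (entHom k).range :=
    ⟨X (m, i, j), by simp [entHom, ents]⟩
  induction g using FreeGroup.induction_on with
  | C1 =>
    intro i j
    convert Subalgebra.algebraMap_mem (entHom k).range ((1 : Matrix (Fin 2) (Fin 2) k) i j)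
      using 1
    funext ρ
    rw [map_one]
    rfl
  | of m => exact hof m
  | inv_of m _ =>
    intro i j
    have h : ∀ ρ : Rep F₃ 2 k, (ρ (FreeGroup.of m)⁻¹).1 = (gen ρ m).adjugate := fun ρ => by
      rw [map_inv]; rfl
    simp only [h, Matrix.adjugate_fin_two]
    fin_cases i <;> fin_cases j
    · exact hof m 1 1
    · exact neg_mem (hof m 0 1)
    · exact neg_mem (hof m 1 0)
    · exact hof m 0 0
  | mul g h hg hh =>
    intro i j
    have e : (fun ρ : Rep F₃ 2 k => (ρ (g * h)).1 i j) =
        ∑ l, (fun ρ : Rep F₃ 2 k => (ρ g).1 i l) * (fun ρ : Rep F₃ 2 k => (ρ h).1 l j) := by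
      funext ρ
      rw [map_mul, Finset.sum_apply]
      exact Matrix.mul_apply
    rw [e]
    exact sum_mem fun l _ => mul_mem (hg i l) (hh l j)

theorem traceRing_le_invariantRing (Γ : Type*) [Group Γ] (r : ℕ) :
    traceRing Γ r k ≤ invariantRing Γ r k := by
  refine Algebra.adjoin_le ?_
  rintro _ ⟨g, rfl⟩
  refine ⟨?_, fun Q ρ => congrFun (character_conjRep Q ρ) g⟩
  have e : (fun ρ : Rep Γ r k => character ρ g) = ∑ i, fun ρ : Rep Γ r k => (ρ g).1 i i := by
    funext ρ
    rw [Finset.sum_apply]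
    rfl
  simp only [e]
  exact sum_mem fun i _ => Algebra.subset_adjoin ⟨(g, i, i), rfl⟩

theorem range_traceHom_le_traceRing : (traceHom k).range ≤ traceRing F₃ 2 k := by
  rw [traceHom, ← Algebra.adjoin_range_eq_range_aeval]
  refine Algebra.adjoin_mono ?_
  rintro _ ⟨i, rfl⟩
  exact ⟨word i, rfl⟩

theorem traceHom_mem_coordRing (p : MvPolynomial (Fin 7) k) :
    traceHom k p ∈ coordRing F₃ 2 k :=
  (traceRing_le_invariantRing _ _ (range_traceHom_le_traceRing ⟨p, rfl⟩)).1

/-! ### Parametrization of the representation space by an affine space -/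

/-- A product of four elementary matrices. -/
def elemProd {R : Type*} [CommRing R] (t : Fin 4 → R) : Matrix (Fin 2) (Fin 2) R :=
  !![1, t 0; 0, 1] * !![1, 0; t 1, 1] * !![1, t 2; 0, 1] * !![1, 0; t 3, 1]

theorem det_elemProd {R : Type*} [CommRing R] (t : Fin 4 → R) : (elemProd t).det = 1 := by
  simp [elemProd, Matrix.det_mul, -Matrix.cons_mul]

theorem exists_elemProd (M : Matrix (Fin 2) (Fin 2) k) (hM : M.det = 1) :
    ∃ t : Fin 4 → k, elemProd t = M := by
  rw [Matrix.det_fin_two] at hM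
  -- Splitting off the last factor makes the lower left entry nonzero; three factors suffice for
  -- such a matrix.
  obtain ⟨d, hd⟩ : ∃ d, M 1 0 - d * M 1 1 ≠ 0 := by
    by_cases h : M 1 0 = 0
    · refine ⟨1, fun h' => ?_⟩
      rw [h] at h' hM
      have : M 1 1 = 0 := by linear_combination -h'
      rw [this] at hM
      simp at hM
    · exact ⟨0, by simpa using h⟩
  refine ⟨![(M 0 0 - d * M 0 1 - 1) / (M 1 0 - d * M 1 1), M 1 0 - d * M 1 1,
    (M 1 1 - 1) / (M 1 0 - d * M 1 1), d], ?_⟩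
  ext i j
  fin_cases i <;> fin_cases j <;>
    simp [elemProd] <;> field_simp
  · linear_combination d * hM
  · linear_combination hM
  · ring
  · ring

theorem eval_elemProd {σ : Type*} (t : σ → k) (a : Fin 4 → MvPolynomial σ k) (i j : Fin 2) :
    eval t (elemProd a i j) = elemProd (fun l => eval t (a l)) i j := by
  fin_cases i <;> fin_cases j <;> simp [elemProd]

/-- The coordinate ring of `SL₂³` is a domain. -/
theorem eq_zero_or_eq_zero_of_mul_eq_zero [Infinite k] {f g : Rep F₃ 2 k → k}
    (hf : f ∈ coordRing F₃ 2 k) (hg : g ∈ coordRing F₃ 2 k) (h : f * g = 0) : f = 0 ∨ g = 0 := by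
  obtain ⟨p, rfl⟩ := coordRing_le_range_entHom hf
  obtain ⟨q, rfl⟩ := coordRing_le_range_entHom hg
  -- Pullback along the surjection `𝔸¹² → SL₂³`. A polynomial in the entries vanishes on `SL₂³`
  -- exactly when its pullback is zero, and the target of `φ` is a domain.
  let φ : MvPolynomial (Fin 3 × Fin 2 × Fin 2) k →ₐ[k] MvPolynomial (Fin 3 × Fin 4) k :=
    aeval fun m => elemProd (fun l => X (m.1, l)) m.2.1 m.2.2
  have hφ (p) (t : Fin 3 × Fin 4 → k) : eval t (φ p) =
      eval (fun m => elemProd (fun l => t (m.1, l)) m.2.1 m.2.2) p := by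
    induction p using MvPolynomial.induction_on with
    | C a => simp [φ]
    | add p q hp hq => simp [hp, hq]
    | mul_X p i hp => simp [hp]; simp [φ, eval_elemProd]
  have key (p) (hp : φ p = 0) : entHom k p = 0 := by
    funext ρ
    choose t ht using fun i => exists_elemProd (gen ρ i) (ρ (FreeGroup.of i)).2
    have := hφ p fun m => t m.1 m.2
    rw [hp, map_zero] at this
    rw [entHom_apply, Pi.zero_apply, this]
    congr 2
    funext m
    simp only [ents, ← ht]
  have hpq : φ p * φ q = 0 := by
    rw [← map_mul]
    refine MvPolynomial.funext fun t => ?_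
    have := congrFun h (mkRep (elemProd fun l => t (0, l)) (elemProd fun l => t (1, l))
      (elemProd fun l => t (2, l)) (det_elemProd _) (det_elemProd _) (det_elemProd _))
    erw [← map_mul, entHom_apply] at this
    rw [hφ, map_zero]
    refine Eq.trans ?_ this
    congr 2
    funext ⟨i, a, b⟩
    fin_cases i <;> simp [ents, mkRep, gen]
  exact (mul_eq_zero.1 hpq).imp (key p) (key q)

/-! ### The ideal of the hypersurface -/

variable (k) in
/-- Polynomials in seven variables, as polynomials in the `i`-th one. -/
def asPoly (i : Fin 7) : MvPolynomial (Fin 7) k ≃ₐ[k] Polynomial (MvPolynomial (Fin 6) k) :=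
  (renameEquiv k (_root_.finSuccEquiv' i)).trans (optionEquivLeft k (Fin 6))

theorem asPoly_X_self (i : Fin 7) : asPoly k i (X i) = Polynomial.X := by
  simp [asPoly]

theorem asPoly_X_succAbove (i : Fin 7) (j : Fin 6) :
    asPoly k i (X (i.succAbove j)) = Polynomial.C (X j) := by
  simp [asPoly]

theorem eval_asPoly (i : Fin 7) (q : Fin 7 → k) (p : MvPolynomial (Fin 7) k) :
    ((asPoly k i p).map (eval fun j => q (i.succAbove j))).eval (q i) = eval q p := by
  induction p using MvPolynomial.induction_on with
  | C a => simp [asPoly]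
  | add p q hp hq => simp [hp, hq]
  | mul_X p j hp =>
    rw [map_mul, Polynomial.map_mul, Polynomial.eval_mul, hp, map_mul]
    congr 1
    rcases Fin.eq_self_or_eq_succAbove i j with rfl | ⟨j, rfl⟩
    · simp [asPoly_X_self]
    · simp [asPoly_X_succAbove]

/-- The trace of `ABC` plus that of `ACB`, as a polynomial in six variables. -/
def linCoeff (k : Type*) [Field k] : MvPolynomial (Fin 6) k :=
  X 5 * X 2 + X 4 * X 1 + X 3 * X 0 - X 0 * X 1 * X 2

/-- The constant coefficient of the equation in the last variable. -/
def constCoeff (k : Type*) [Field k] : MvPolynomial (Fin 6) k :=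
  - X 0 ^ 2 - X 1 ^ 2 - X 2 ^ 2 + X 3 * X 1 * X 2 + X 4 * X 0 * X 2 + X 5 * X 0 * X 1
    - X 3 * X 4 * X 5 - X 3 ^ 2 - X 4 ^ 2 - X 5 ^ 2 + 4

theorem asPoly_defPoly : asPoly k 6 (defPoly k) = Polynomial.X ^ 2
    - (Polynomial.C (linCoeff k) * Polynomial.X + Polynomial.C (constCoeff k)) := by
  have h0 := asPoly_X_succAbove (k := k) 6 0
  have h1 := asPoly_X_succAbove (k := k) 6 1
  have h2 := asPoly_X_succAbove (k := k) 6 2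
  have h3 := asPoly_X_succAbove (k := k) 6 3
  have h4 := asPoly_X_succAbove (k := k) 6 4
  have h5 := asPoly_X_succAbove (k := k) 6 5
  have h6 := asPoly_X_self (k := k) 6
  simp only [show (6 : Fin 7).succAbove 0 = 0 from rfl, show (6 : Fin 7).succAbove 1 = 1 from rfl,
    show (6 : Fin 7).succAbove 2 = 2 from rfl, show (6 : Fin 7).succAbove 3 = 3 from rfl,
    show (6 : Fin 7).succAbove 4 = 4 from rfl, show (6 : Fin 7).succAbove 5 = 5 from rfl]
    at h0 h1 h2 h3 h4 h5
  simp only [defPoly, linCoeff, constCoeff, map_sub, map_add, map_mul, map_pow, map_neg,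
    h0, h1, h2, h3, h4, h5, h6, map_ofNat]
  ring

theorem monic_asPoly_defPoly : (asPoly k 6 (defPoly k)).Monic := by
  rw [asPoly_defPoly]
  monicity!

theorem degree_asPoly_defPoly : (asPoly k 6 (defPoly k)).degree = 2 := by
  rw [asPoly_defPoly]
  compute_degree!

/-- The discriminant takes the coprime values 9 and 16 at the two points, so it is nonzero in every
characteristic. -/
theorem disc_ne_zero : linCoeff k ^ 2 + 4 * constCoeff k ≠ 0 := by
  intro h
  have h1 := congrArg (eval ![0, 0, 1, 0, 0, 1]) h
  have h2 := congrArg (eval ![0, 0, 0, 0, 0, 0]) h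
  simp [linCoeff, constCoeff] at h1 h2
  norm_num at h1 h2
  have : (1 : k) = 0 := by linear_combination h1 - 2 * h2
  exact one_ne_zero this

/-- A polynomial of degree at most one in the last variable that vanishes on the hypersurface is
zero. -/
theorem eq_zero_of_degree_lt_of_vanish [IsAlgClosed k] (p : MvPolynomial (Fin 7) k)
    (hd : (asPoly k 6 p).degree < 2) (h : ∀ q, IsFricke q → eval q p = 0) : p = 0 := by
  obtain ⟨a, b, hab⟩ : ∃ a b, asPoly k 6 p = Polynomial.C a * Polynomial.X + Polynomial.C b :=
    Polynomial.exists_eq_X_add_C_of_natDegree_le_one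
      (Polynomial.natDegree_le_of_degree_le (Order.le_of_lt_succ hd))
  have hv (r : Fin 6 → k) (P : k)
      (hP : P ^ 2 - eval r (linCoeff k) * P + -eval r (constCoeff k) = 0) :
      eval r a * P + eval r b = 0 := by
    have hq := eval_asPoly 6 (Fin.snoc r P : Fin 7 → k)
    have e : (fun j => (Fin.snoc r P : Fin 7 → k) ((6 : Fin 7).succAbove j)) = r := by
      funext j
      have : (6 : Fin 7).succAbove j = Fin.castSucc j := Fin.succAbove_last_apply j
      rw [this, Fin.snoc_castSucc]
    have e' : (Fin.snoc r P : Fin 7 → k) 6 = P := Fin.snoc_last (α := fun _ => k) P r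
    rw [e, e'] at hq
    have h1 := h (Fin.snoc r P) (by
      rw [← eval_defPoly, ← hq, asPoly_defPoly]
      simp
      linear_combination hP)
    rw [← hq, hab] at h1
    simpa using h1
  have ha : a = 0 := by
    -- Subtracting the values at the roots `P` and `L - P`, where `L` is `linCoeff`, gives `a (2P -
    -- L) = 0`, and `(2P - L)²` is the discriminant.
    have : a * (linCoeff k ^ 2 + 4 * constCoeff k) = 0 := by
      refine MvPolynomial.funext fun r => ?_
      obtain ⟨P, hP⟩ := exists_quadratic_root (eval r (linCoeff k)) (-eval r (constCoeff k))
      have h1 := hv r P hP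
      have h2 := hv r (eval r (linCoeff k) - P) (by linear_combination hP)
      simp only [map_mul, map_add, map_pow, map_ofNat, map_zero]
      linear_combination (2 * P - eval r (linCoeff k)) * (h1 - h2) - 4 * eval r a * hP
    exact (mul_eq_zero.1 this).resolve_right disc_ne_zero
  have hb : b = 0 := by
    refine MvPolynomial.funext fun r => ?_
    obtain ⟨P, hP⟩ := exists_quadratic_root (eval r (linCoeff k)) (-eval r (constCoeff k))
    have h1 := hv r P hP
    simpa [ha] using h1
  rw [ha, hb] at hab
  simpa using hab

/-- Division with remainder by the equation. -/
theorem exists_reduced (p : MvPolynomial (Fin 7) k) :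
    ∃ r d, (asPoly k 6 r).degree < 2 ∧ p = r + defPoly k * d := by
  refine ⟨(asPoly k 6).symm (asPoly k 6 p %ₘ asPoly k 6 (defPoly k)),
    (asPoly k 6).symm (asPoly k 6 p /ₘ asPoly k 6 (defPoly k)), ?_, ?_⟩
  · rw [AlgEquiv.apply_symm_apply, ← degree_asPoly_defPoly (k := k)]
    exact Polynomial.degree_modByMonic_lt _ monic_asPoly_defPoly
  · apply (asPoly k 6).injective
    simp [Polynomial.modByMonic_add_div]

/-- The equation divides every polynomial that vanishes on the hypersurface. -/
theorem defPoly_dvd_of_vanish [IsAlgClosed k] (p : MvPolynomial (Fin 7) k)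
    (h : ∀ q, IsFricke q → eval q p = 0) : defPoly k ∣ p := by
  obtain ⟨r, d, hr, rfl⟩ := exists_reduced p
  rw [eq_zero_of_degree_lt_of_vanish r hr fun q hq => ?_, zero_add]
  · exact dvd_mul_right _ _
  · simpa [(eval_defPoly q).2 hq] using h q hq

/-! ### Invariants -/

/-- Clearing denominators in a polynomial evaluated at fractions with denominator `κ`. -/
theorem exists_clear_denominators {σ : Type*} (e : σ → Polynomial (MvPolynomial (Fin 7) k))
    (κ : MvPolynomial (Fin 7) k) (p : MvPolynomial σ k) :
    ∃ (N : ℕ) (G : Polynomial (MvPolynomial (Fin 7) k)), ∀ (q : Fin 7 → k) (s : k) (c : σ → k),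
      (∀ m, eval q κ * c m = (e m).eval₂ (eval q) s) →
      eval q κ ^ N * eval c p = G.eval₂ (eval q) s := by
  induction p using MvPolynomial.induction_on with
  | C a => exact ⟨0, Polynomial.C (C a), fun q s c _ => by simp⟩
  | add p₁ p₂ h₁ h₂ =>
    obtain ⟨N₁, G₁, h₁⟩ := h₁
    obtain ⟨N₂, G₂, h₂⟩ := h₂
    refine ⟨N₁ + N₂, (Polynomial.C κ) ^ N₂ * G₁ + (Polynomial.C κ) ^ N₁ * G₂,
      fun q s c h => ?_⟩
    simp only [Polynomial.eval₂_add, Polynomial.eval₂_mul, Polynomial.eval₂_pow,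
      Polynomial.eval₂_C, map_add, ← h₁ q s c h, ← h₂ q s c h]
    ring
  | mul_X p m hp =>
    obtain ⟨N, G, hG⟩ := hp
    refine ⟨N + 1, G * e m, fun q s c h => ?_⟩
    rw [Polynomial.eval₂_mul, ← hG q s c h, ← h m, map_mul, eval_X]
    ring

theorem map_kappa {R S : Type*} [CommRing R] [CommRing S] (φ : R →+* S) (x y w : R) :
    φ (kappa x y w) = kappa (φ x) (φ y) (φ w) := by
  simp [kappa, map_ofNat]

theorem map_slice {R S : Type*} [CommRing R] [CommRing S] (φ : R →+* S) (q : Fin 7 → R) (s : R)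
    (m : Fin 3) (i j : Fin 2) : φ (slice q s m i j) = slice (fun l => φ (q l)) (φ s) m i j := by
  fin_cases m <;> fin_cases i <;> fin_cases j <;>
    simp [slice, sliceEntry₁, sliceEntry₃, map_kappa, map_ofNat]

theorem kappa_ne_zero {σ : Type*} {a b c : σ} (hb : b ≠ a) (hc : c ≠ a) :
    kappa (X a) (X b) (X c) ≠ (0 : MvPolynomial σ k) := by
  classical
  intro h
  have h1 := congrArg (eval fun _ => (0 : k)) h
  have h2 := congrArg (eval fun i => if i = a then (1 : k) else 0) h
  simp [kappa, hb, hc, map_ofNat] at h1 h2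
  have : (1 : k) = 0 := by linear_combination h2 + h1
  exact one_ne_zero this

theorem X_sq_sub_four_ne_zero {σ : Type*} (a : σ) : (X a ^ 2 - 4 : MvPolynomial σ k) ≠ 0 := by
  intro h
  have h1 := congrArg (eval fun _ => (0 : k)) h
  have h2 := congrArg (eval fun _ => (1 : k)) h
  simp [map_ofNat] at h1 h2
  have : (1 : k) = 0 := by linear_combination h2 + h1
  exact one_ne_zero this

/-- The hypothesis says that `p` does not involve `P`, and the other six traces take all values. -/
theorem traceHom_ne_zero_of_six [IsAlgClosed k] (p : MvPolynomial (Fin 7) k) (hp : p ≠ 0)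
    (h : ∀ q P, eval (Function.update q 6 P) p = eval q p) : traceHom k p ≠ 0 := by
  intro h0
  refine hp (MvPolynomial.funext fun q => ?_)
  obtain ⟨ρ, P, hρ⟩ := exists_rep_six q
  have := congrFun h0 ρ
  rwa [traceHom_apply, hρ, h] at this

/-- An invariant function becomes a polynomial in the seven traces after multiplication by a
power of `kappa`. -/
theorem exists_kappa_pow_mul_eq [IsAlgClosed k] {f : Rep F₃ 2 k → k}
    (hf : f ∈ invariantRing F₃ 2 k) : ∃ (N : ℕ) (G : MvPolynomial (Fin 7) k),
      traceHom k (kappa (X 0) (X 1) (X 5)) ^ N * f = traceHom k G := by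
  obtain ⟨p, hp⟩ := coordRing_le_range_entHom hf.1
  have hp (ρ) : f ρ = eval (ents ρ) p := by rw [← hp]; exact entHom_apply p ρ
  set κ : MvPolynomial (Fin 7) k := kappa (X 0) (X 1) (X 5) with hκ
  have hκe (q : Fin 7 → k) : eval q κ = kappa (q 0) (q 1) (q 5) := by simp [hκ, map_kappa]
  obtain ⟨N, G, hG⟩ := exists_clear_denominators
    (fun m => slice (fun i => Polynomial.C (X i)) Polynomial.X m.1 m.2.1 m.2.2) κ p
  set c : Polynomial (MvPolynomial (Fin 7) k) :=
    Polynomial.X ^ 2 - Polynomial.C (X 5) * Polynomial.X + 1 with hc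
  have hcm : c.Monic := by rw [hc]; monicity!
  have hcd : c.degree = 2 := by rw [hc]; compute_degree!
  obtain ⟨a, b, hab⟩ : ∃ a b, G %ₘ c = Polynomial.C a * Polynomial.X + Polynomial.C b := by
    refine Polynomial.exists_eq_X_add_C_of_natDegree_le_one
      (Polynomial.natDegree_le_of_degree_le (Order.le_of_lt_succ ?_))
    have := Polynomial.degree_modByMonic_lt G hcm
    rwa [hcd] at this
  -- By invariance `f` may be evaluated at the normal form; powers of `s` are reduced modulo `s² - w
  -- s + 1`.
  have key (ρ : Rep F₃ 2 k) (h0 : eval (tvec ρ) κ ≠ 0) (s : k)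
      (hs : s ^ 2 - tvec ρ 5 * s + 1 = 0) :
      eval (tvec ρ) κ ^ N * f ρ = eval (tvec ρ) a * s + eval (tvec ρ) b := by
    rw [hκe] at h0
    obtain ⟨Q, hQ⟩ := exists_conjRep_normalized ρ hs h0
    rw [← hf.2 Q ρ, hp, hG (tvec ρ) s]
    · rw [← Polynomial.modByMonic_add_div G c, hab]
      have : c.eval₂ (eval (tvec ρ)) s = 0 := by
        rw [← hs, hc]
        simp [Polynomial.eval₂_sub]
      simp [Polynomial.eval₂_add, Polynomial.eval₂_mul, this]
    · rintro ⟨m, i, j⟩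
      rw [hκe]
      have h1 := congrFun (congrFun (hQ m) i) j
      rw [Matrix.smul_apply, smul_eq_mul] at h1
      refine h1.trans ?_
      have := map_slice (Polynomial.eval₂RingHom (eval (tvec ρ)) s)
        (fun i => Polynomial.C (X i)) Polynomial.X m i j
      simp only [Polynomial.coe_eval₂RingHom, Polynomial.eval₂_C, Polynomial.eval₂_X, eval_X]
        at this
      exact this.symm
  refine ⟨N, b, ?_⟩
  -- Comparing the eigenvalues `s` and `w - s` kills `a` where `κ (w² - 4) ≠ 0`. This factor is
  -- cancelled afterwards because the coordinate ring is a domain.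
  have hz : traceHom k (κ * (X 5 ^ 2 - 4)) * (traceHom k κ ^ N * f - traceHom k b) = 0 := by
    funext ρ
    simp only [Pi.mul_apply, Pi.sub_apply, Pi.pow_apply, traceHom_apply, Pi.zero_apply]
    simp only [map_mul, map_sub, map_pow, eval_X, map_ofNat]
    by_cases h0 : eval (tvec ρ) κ = 0
    · simp [h0]
    obtain ⟨s, hs⟩ := exists_quadratic_root (tvec ρ 5) 1
    have h1 := key ρ h0 s hs
    have h2 := key ρ h0 (tvec ρ 5 - s) (by linear_combination hs)
    have h3 : eval (tvec ρ) a * (tvec ρ 5 ^ 2 - 4) = 0 := by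
      linear_combination (2 * s - tvec ρ 5) * (h2 - h1) - 4 * eval (tvec ρ) a * hs
    rw [h1]
    linear_combination eval (tvec ρ) κ * s * h3
  have hmem : traceHom k κ ^ N * f - traceHom k b ∈ coordRing F₃ 2 k :=
    sub_mem (mul_mem (pow_mem (traceHom_mem_coordRing _) _) hf.1) (traceHom_mem_coordRing _)
  rcases eq_zero_or_eq_zero_of_mul_eq_zero (traceHom_mem_coordRing _) hmem hz with h | h
  · refine absurd h (traceHom_ne_zero_of_six _ (mul_ne_zero
      (kappa_ne_zero (by decide) (by decide)) (X_sq_sub_four_ne_zero 5)) fun q P => ?_)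
    simp [hκe, Function.update]
  · exact sub_eq_zero.1 h

theorem comp_swapRep_mem_coordRing {f : Rep F₃ 2 k → k} (hf : f ∈ coordRing F₃ 2 k) :
    (fun ρ => f (swapRep ρ)) ∈ coordRing F₃ 2 k := by
  induction hf using Algebra.adjoin_induction with
  | mem f h =>
    obtain ⟨⟨g, i, j⟩, rfl⟩ := h
    exact Algebra.subset_adjoin ⟨(FreeGroup.map (Equiv.swap (1 : Fin 3) 2) g, i, j), rfl⟩
  | algebraMap c => exact Subalgebra.algebraMap_mem _ c
  | add f g _ _ hf hg => exact add_mem hf hg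
  | mul f g _ _ hf hg => exact mul_mem hf hg

/-- The analogue of `exists_kappa_pow_mul_eq` for the first and third generators. -/
theorem exists_kappa_pow_mul_eq' [IsAlgClosed k] {f : Rep F₃ 2 k → k}
    (hf : f ∈ invariantRing F₃ 2 k) : ∃ (N : ℕ) (G : MvPolynomial (Fin 7) k),
      traceHom k (kappa (X 0) (X 2) (X 4)) ^ N * f = traceHom k G := by
  have hf' : (fun ρ => f (swapRep ρ)) ∈ invariantRing F₃ 2 k :=
    ⟨comp_swapRep_mem_coordRing hf.1, fun Q ρ => hf.2 Q (swapRep ρ)⟩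
  obtain ⟨N, G, hG⟩ := exists_kappa_pow_mul_eq hf'
  refine ⟨N, bind₁ (swapVec X) G, ?_⟩
  funext ρ
  have h := congrFun hG (swapRep ρ)
  simp only [Pi.mul_apply, Pi.pow_apply, traceHom_apply, swapRep_swapRep, tvec_swapRep, map_kappa,
    eval_X] at h ⊢
  have e : eval (swapVec (tvec ρ)) G = eval (tvec ρ) (bind₁ (swapVec X) G) := by
    rw [eval, eval, MvPolynomial.eval₂Hom_bind₁]
    congr 2
    funext i
    fin_cases i <;> simp [swapVec, traceSum]
  rw [← e, ← h]
  simp [swapVec]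

/-! ### Removing the denominators -/

theorem asPoly_kappa (i : Fin 7) (a b c : Fin 6) :
    asPoly k i (kappa (X (i.succAbove a)) (X (i.succAbove b)) (X (i.succAbove c))) =
      Polynomial.C (kappa (X a) (X b) (X c)) := by
  simp [kappa, asPoly_X_succAbove, map_ofNat]

/-- The two multipliers `kappa` are coprime. -/
theorem kappa_pow_dvd_of_dvd_mul (N M : ℕ) (r : MvPolynomial (Fin 7) k)
    (h : kappa (X 0) (X 1) (X 5) ^ N ∣ kappa (X 0) (X 2) (X 4) ^ M * r) :
    kappa (X 0) (X 1) (X 5) ^ N ∣ r := by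
  have h2 : asPoly k 5 (kappa (X 0) (X 2) (X 4)) = Polynomial.C (kappa (X 0) (X 2) (X 4)) :=
    asPoly_kappa 5 0 2 4
  have h1 : (asPoly k 5 (kappa (X 0) (X 1) (X 5))).Monic := by
    have e0 : asPoly k 5 (X 0) = Polynomial.C (X 0) := asPoly_X_succAbove 5 0
    have e1 : asPoly k 5 (X 1) = Polynomial.C (X 1) := asPoly_X_succAbove 5 1
    have : asPoly k 5 (kappa (X 0) (X 1) (X 5)) = Polynomial.X ^ 2
        - Polynomial.C (X 0 * X 1) * Polynomial.X + Polynomial.C (X 0 ^ 2 + X 1 ^ 2 - 4) := by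
      simp [kappa, e0, e1, asPoly_X_self, map_ofNat]
      ring
    rw [this]
    monicity!
  have hm := h1.pow N
  rw [← map_dvd_iff (asPoly k 5)] at h ⊢
  simp only [map_mul, map_pow, h2] at h ⊢
  -- `kappa x y w` is monic in `w`, while `kappa x z v` is a nonzero constant in `w`, which passes
  -- through the remainder.
  rw [← Polynomial.modByMonic_eq_zero_iff_dvd hm] at h ⊢
  rw [← Polynomial.C_pow, ← Polynomial.smul_eq_C_mul, Polynomial.smul_modByMonic] at h
  exact (smul_eq_zero.1 h).resolve_left (pow_ne_zero _ (kappa_ne_zero (by decide) (by decide)))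

theorem invariantRing_le_range_traceHom [IsAlgClosed k] :
    invariantRing F₃ 2 k ≤ (traceHom k).range := by
  intro f hf
  obtain ⟨N, G₁, h₁⟩ := exists_kappa_pow_mul_eq hf
  obtain ⟨M, G₂, h₂⟩ := exists_kappa_pow_mul_eq' hf
  obtain ⟨r₁, d₁, hr₁, rfl⟩ := exists_reduced G₁
  obtain ⟨r₂, d₂, hr₂, rfl⟩ := exists_reduced G₂
  have hz : traceHom k (defPoly k) = 0 := by
    funext ρ
    rw [traceHom_apply]
    exact (eval_defPoly _).2 (isFricke_tvec ρ)
  simp only [map_add, map_mul, hz, zero_mul, add_zero] at h₁ h₂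
  -- Both products represent `κ ^ N * κ' ^ M * f` and are of degree at most one in `P`, so they
  -- agree as polynomials, not merely on the hypersurface.
  have e : kappa (X 0) (X 2) (X 4) ^ M * r₁ - kappa (X 0) (X 1) (X 5) ^ N * r₂ = 0 := by
    apply eq_zero_of_degree_lt_of_vanish
    · have k1 : asPoly k 6 (kappa (X 0) (X 1) (X 5)) = Polynomial.C (kappa (X 0) (X 1) (X 5)) :=
        asPoly_kappa 6 0 1 5
      have k2 : asPoly k 6 (kappa (X 0) (X 2) (X 4)) = Polynomial.C (kappa (X 0) (X 2) (X 4)) :=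
        asPoly_kappa 6 0 2 4
      simp only [map_sub, map_mul, map_pow, k1, k2]
      simp only [← Polynomial.C_pow, ← Polynomial.smul_eq_C_mul]
      exact (Polynomial.degree_sub_le _ _).trans_lt (max_lt
        ((Polynomial.degree_smul_le _ _).trans_lt hr₁)
        ((Polynomial.degree_smul_le _ _).trans_lt hr₂))
    · intro q hq
      obtain ⟨ρ, rfl⟩ := exists_rep q hq
      rw [← traceHom_apply]
      simp only [map_sub, map_mul, map_pow, ← h₁, ← h₂]
      simp only [Pi.sub_apply, Pi.mul_apply, Pi.pow_apply]
      ring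
  obtain ⟨g, rfl⟩ := kappa_pow_dvd_of_dvd_mul N M r₁ ⟨r₂, sub_eq_zero.1 e⟩
  have h : traceHom k (kappa (X 0) (X 1) (X 5) ^ N) * (f - traceHom k g) = 0 := by
    rw [mul_sub, map_pow, h₁, map_mul, map_pow, sub_self]
  rcases eq_zero_or_eq_zero_of_mul_eq_zero (traceHom_mem_coordRing _)
    (sub_mem hf.1 (traceHom_mem_coordRing _)) h with h | h
  · refine absurd h (traceHom_ne_zero_of_six _ (pow_ne_zero _
      (kappa_ne_zero (by decide) (by decide))) fun q P => ?_)
    simp [map_kappa, Function.update]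
  · exact ⟨g, (sub_eq_zero.1 h).symm⟩

/-! ### The embedding of the character variety -/

theorem range_coords [IsAlgClosed k] : Set.range (coords k) = {q | IsFricke q} := by
  ext q
  constructor
  · rintro ⟨⟨_, ρ, rfl⟩, rfl⟩
    exact isFricke_tvec ρ
  · intro hq
    obtain ⟨ρ, rfl⟩ := exists_rep q hq
    exact ⟨⟨_, ρ, rfl⟩, rfl⟩

theorem range_traceHom_eq_traceRing [IsAlgClosed k] :
    (traceHom k).range = traceRing F₃ 2 k :=
  le_antisymm range_traceHom_le_traceRing
    ((traceRing_le_invariantRing _ _).trans invariantRing_le_range_traceHom)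

theorem coords_injective [IsAlgClosed k] : Function.Injective (coords k) := by
  rintro ⟨_, ρ, rfl⟩ ⟨_, ρ', rfl⟩ h
  have h : tvec ρ = tvec ρ' := h
  refine Subtype.ext (funext fun g => ?_)
  obtain ⟨p, hp⟩ : (fun ρ : Rep F₃ 2 k => character ρ g) ∈ (traceHom k).range := by
    rw [range_traceHom_eq_traceRing]
    exact Algebra.subset_adjoin ⟨g, rfl⟩
  have hp (σ : Rep F₃ 2 k) : eval (tvec σ) p = character σ g := by
    rw [← traceHom_apply]
    exact congrFun hp σ
  change character ρ g = character ρ' g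
  rw [← hp, ← hp, h]

end CharVar

end

theorem mainTheorem2 (k : Type*) [Field k] [IsAlgClosed k] :
    -- the seven traces embed the character variety in `k⁷`
    Function.Injective (CharVar.coords k) ∧
    -- the image is the zero set of the equation
    Set.range (CharVar.coords k) =
      {p : Fin 7 → k | ∃ x y z u v w P : k, p = ![x, y, z, u, v, w, P] ∧
        P ^ 2 = (w * z + v * y + u * x - x * y * z) * P - x ^ 2 - y ^ 2 - z ^ 2
          + u * y * z + v * x * z + w * x * y - u * v * w - u ^ 2 - v ^ 2 - w ^ 2 + 4} ∧
    -- the ideal of the image is generated by the equation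
    MvPolynomial.vanishingIdeal k (Set.range (CharVar.coords k)) =
      Ideal.span {CharVar.defPoly k} ∧
    -- `k[x, y, z, u, v, w, P] / (equation)` is the ring of functions of the character variety
    RingHom.ker (CharVar.traceHom k) = Ideal.span {CharVar.defPoly k} ∧
    (CharVar.traceHom k).range = CharVar.traceRing CharVar.F₃ 2 k ∧
    -- and of the GIT quotient of `(SL₂)³` by conjugation
    (CharVar.traceHom k).range = CharVar.invariantRing CharVar.F₃ 2 k := by
  have hI (p : MvPolynomial (Fin 7) k) :
      (∀ q, CharVar.IsFricke q → eval q p = 0) ↔ p ∈ Ideal.span {CharVar.defPoly k} := by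
    rw [Ideal.mem_span_singleton]
    refine ⟨CharVar.defPoly_dvd_of_vanish p, ?_⟩
    rintro ⟨d, rfl⟩ q hq
    rw [map_mul, (CharVar.eval_defPoly q).2 hq, zero_mul]
  refine ⟨CharVar.coords_injective, ?_, ?_, ?_, CharVar.range_traceHom_eq_traceRing,
    le_antisymm (CharVar.range_traceHom_le_traceRing.trans
      (CharVar.traceRing_le_invariantRing _ _)) CharVar.invariantRing_le_range_traceHom⟩
  · rw [CharVar.range_coords]
    ext q
    constructor
    · intro hq
      refine ⟨q 0, q 1, q 2, q 3, q 4, q 5, q 6, ?_, hq⟩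
      funext i
      fin_cases i <;> rfl
    · rintro ⟨x, y, z, u, v, w, P, rfl, h⟩
      exact h
  · ext p
    rw [← hI, CharVar.range_coords]
    simp [MvPolynomial.mem_vanishingIdeal_iff, MvPolynomial.aeval_eq_eval]
  · ext p
    rw [← hI, RingHom.mem_ker]
    constructor
    · intro h q hq
      obtain ⟨ρ, rfl⟩ := CharVar.exists_rep q hq
      rw [← CharVar.traceHom_apply, h, Pi.zero_apply]
    · intro h
      funext ρ
      rw [CharVar.traceHom_apply, h _ (CharVar.isFricke_tvec ρ), Pi.zero_apply]
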